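/- \textbf{Theorem (Hilbert's syzygy theorem for finite direct products).} Let $R\cong\prod_{i=1}^{k}R_i/N_iR_i$, where $k\ge 0$, each $R_i$ is a principal ideal domain and $N_i\in R_i$ (the value $N_i=0$ is allowed, so that a factor may be the PID $R_i$ itself). Let $n\ge 0$, let $S=R[x_1,\dots,x_n]$, and let $M$ be a finitely generated $S$-module. Then there are an index $p\le n+1$ and an exact sequence of $S$-modules $$ \cdots\to F_p\to F_p\to F_p\to F_{p-1}\to\cdots\to F_1\to F_0\to M\to 0 $$ in which every module $F_i$ is free of finite rank, and in which the module in every degree $i\ge p$ is (isomorphic to) the same free module $F_p$; the maps between the copies of $F_p$ are not required to be equal. The same conclusion holds if $R$ is any commutative principal ideal ring with unit (not necessarily a domain). -/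

import Mathlib

universe u v w

/-- A free resolution `⋯ → F₂ → F₁ → F₀ → M → 0` of an `S`-module `M`: free `S`-modules `F i`
and `S`-linear maps, exact at every place. -/
structure FreeResolution (S : Type u) [CommRing S] (M : Type v) [AddCommGroup M] [Module S M] where
  /-- the modules of the resolution -/
  F : ℕ → Type u
  [addCommGroup : ∀ i, AddCommGroup (F i)]
  [module : ∀ i, Module S (F i)]
  [free : ∀ i, Module.Free S (F i)]
  /-- the differential from degree `i + 1` to degree `i` -/
  d : ∀ i, F (i + 1) →ₗ[S] F i
  /-- the augmentation -/
  aug : F 0 →ₗ[S] M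
  aug_surjective : Function.Surjective aug
  exact_zero : Function.Exact (d 0) aug
  exact_succ : ∀ i, Function.Exact (d (i + 1)) (d i)

attribute [instance] FreeResolution.addCommGroup FreeResolution.module FreeResolution.free

namespace FreeResolution

variable {S : Type u} [CommRing S] {M : Type v} [AddCommGroup M] [Module S M]

/-- Every module of the resolution is finitely generated (so it is free of finite rank). -/
def FiniteRank (P : FreeResolution S M) : Prop :=
  ∀ i, Module.Finite S (P.F i)

/-- From index `p` on the resolution repeats the same free module `F p`, that is, it has the shape
`⋯ → F_p → F_p → F_p → F_{p-1} → ⋯ → F_1 → F_0 → M → 0`. -/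
def RepeatsFrom (P : FreeResolution S M) (p : ℕ) : Prop :=
  ∀ i, p ≤ i → Nonempty (P.F i ≃ₗ[S] P.F p)

end FreeResolution

/-- A free resolution of `M` with ranks `r`, described coinductively: a family of classes of modules
containing `M` in degree `0`, whose members in degree `i` are quotients of `S ^ r i`
by a member in degree `i + 1`. -/
def HasRes (S : Type u) [CommRing S] (r : ℕ → ℕ) (M : Type u) [AddCommGroup M] [Module S M] :
    Prop :=
  ∃ P : ℕ → ∀ (K : Type u) [AddCommGroup K] [Module S K], Prop, P 0 M ∧
    ∀ (i : ℕ) (K : Type u) [AddCommGroup K] [Module S K], P i K →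
      ∃ (L : Type u) (_ : AddCommGroup L) (_ : Module S L)
        (g : L →ₗ[S] (Fin (r i) → S)) (f : (Fin (r i) → S) →ₗ[S] K),
        Function.Injective g ∧ Function.Exact g f ∧ Function.Surjective f ∧ P (i + 1) L

namespace HasRes

open Function

section Basic

variable {S : Type u} [CommRing S] {M : Type u} [AddCommGroup M] [Module S M]

/-- The first step of a resolution. -/
theorem exists_step {r : ℕ → ℕ} (h : HasRes S r M) :
    ∃ (L : Type u) (_ : AddCommGroup L) (_ : Module S L)
      (g : L →ₗ[S] (Fin (r 0) → S)) (f : (Fin (r 0) → S) →ₗ[S] M),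
      Injective g ∧ Exact g f ∧ Surjective f ∧ HasRes S (fun i => r (i + 1)) L := by
  obtain ⟨P, h0, hP⟩ := h
  obtain ⟨L, _, _, g, f, hg, hgf, hf, hL⟩ := hP 0 M h0
  exact ⟨L, _, _, g, f, hg, hgf, hf, fun i => P (i + 1), hL, fun i K _ _ hK => hP (i + 1) K hK⟩

/-- A resolution of the kernel of `S ^ m → M` extends to a resolution of `M`. -/
theorem cons {m : ℕ} {r : ℕ → ℕ} {L : Type u} [AddCommGroup L] [Module S L]
    (g : L →ₗ[S] (Fin m → S)) (f : (Fin m → S) →ₗ[S] M) (hg : Injective g) (hgf : Exact g f)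
    (hf : Surjective f) (h : HasRes S r L) : HasRes S (fun i => Nat.casesOn i m r) M := by
  obtain ⟨P, h0, hP⟩ := h
  let Q : ℕ → ∀ (K : Type u) [AddCommGroup K] [Module S K], Prop
    | 0, K, _, _ => ∃ (L : Type u) (_ : AddCommGroup L) (_ : Module S L)
      (g : L →ₗ[S] (Fin m → S)) (f : (Fin m → S) →ₗ[S] K),
      Injective g ∧ Exact g f ∧ Surjective f ∧ P 0 L
    | i + 1, K, _, _ => P i K
  refine ⟨Q, ⟨L, _, _, g, f, hg, hgf, hf, h0⟩, ?_⟩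
  rintro (_ | i) K _ _ hK
  · exact hK
  · exact hP i K hK

/-- The horseshoe lemma, for one step. -/
theorem horseshoe {A B C FA FC KA KC : Type u} [AddCommGroup A] [AddCommGroup B] [AddCommGroup C]
    [AddCommGroup FA] [AddCommGroup FC] [AddCommGroup KA] [AddCommGroup KC] [Module S A]
    [Module S B] [Module S C] [Module S FA] [Module S FC] [Module S KA] [Module S KC]
    [Module.Projective S FC]
    {a : A →ₗ[S] B} {b : B →ₗ[S] C} (ha : Injective a) (hab : Exact a b) (hb : Surjective b)
    {gA : KA →ₗ[S] FA} {fA : FA →ₗ[S] A} (hgA : Injective gA) (hA : Exact gA fA)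
    (hfA : Surjective fA) {gC : KC →ₗ[S] FC} {fC : FC →ₗ[S] C} (hgC : Injective gC)
    (hC : Exact gC fC) (hfC : Surjective fC) :
    ∃ (f : (FA × FC) →ₗ[S] B) (a' : KA →ₗ[S] LinearMap.ker f) (b' : LinearMap.ker f →ₗ[S] KC),
      Surjective f ∧ Injective a' ∧ Exact a' b' ∧ Surjective b' := by
  obtain ⟨l, hl⟩ := Module.projective_lifting_property b fC hb
  have hl' (c : FC) : b (l c) = fC c := LinearMap.congr_fun hl c
  let f : (FA × FC) →ₗ[S] B := (a ∘ₗ fA).coprod l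
  have hf (p : FA × FC) : f p = a (fA p.1) + l p.2 := rfl
  have hba (y : A) : b (a y) = 0 := hab.apply_apply_eq_zero y
  have hb' (p : LinearMap.ker f) : ∃ k, gC k = p.1.2 := by
    refine (hC _).1 ?_
    have := congrArg b (show f p = 0 from p.2)
    simpa [hf, hba, hl'] using this
  let b' : LinearMap.ker f →ₗ[S] KC := LinearMap.codRestrictOfInjective
    (LinearMap.snd S FA FC ∘ₗ (LinearMap.ker f).subtype) gC hgC hb'
  have hb'' (p : LinearMap.ker f) : gC (b' p) = p.1.2 :=
    LinearMap.codRestrictOfInjective_comp_apply _ _ hgC hb' p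
  let a' : KA →ₗ[S] LinearMap.ker f := (LinearMap.inl S FA FC ∘ₗ gA).codRestrict _ fun k => by
    simp [hf, hA.apply_apply_eq_zero k]
  have ha' (k : KA) : (a' k : FA × FC) = (gA k, 0) := rfl
  refine ⟨f, a', b', fun y => ?_, fun k k' h => hgA ?_, fun p => ⟨fun h => ?_, ?_⟩, fun k => ?_⟩
  · obtain ⟨c, hc⟩ := hfC (b y)
    obtain ⟨z, hz⟩ := (hab (y - l c)).1 (by simp [hl', hc])
    obtain ⟨w, rfl⟩ := hfA z
    exact ⟨(w, c), by simp [hf, hz]⟩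
  · simpa [ha'] using congrArg Subtype.val h
  · have h2 : p.1.2 = 0 := by rw [← hb'', h, map_zero]
    have h1 : f p = 0 := p.2
    obtain ⟨k, hk⟩ := (hA p.1.1).1 (ha (by simpa [hf, h2] using h1))
    exact ⟨k, Subtype.ext (Prod.ext (by simp [ha', hk]) (by simp [ha', h2]))⟩
  · rintro ⟨k, rfl⟩
    exact hgC (by simp [hb'', ha'])
  · obtain ⟨z, hz⟩ := (hab (l (gC k))).1 (by simp [hl', hC.apply_apply_eq_zero k])
    obtain ⟨w, rfl⟩ := hfA z
    exact ⟨⟨(-w, gC k), by simp [hf, hz]⟩, hgC (by simp [hb''])⟩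

/-- Resolutions of the outer terms of a short exact sequence give one of the middle term. -/
theorem extension {r s : ℕ → ℕ} {A B C : Type u} [AddCommGroup A] [AddCommGroup B] [AddCommGroup C]
    [Module S A] [Module S B] [Module S C] {a : A →ₗ[S] B} {b : B →ₗ[S] C} (ha : Injective a)
    (hab : Exact a b) (hb : Surjective b) (hA : HasRes S r A) (hC : HasRes S s C) :
    HasRes S (fun i => r i + s i) B := by
  obtain ⟨P, hP0, hP⟩ := hA
  obtain ⟨Q, hQ0, hQ⟩ := hC
  refine ⟨fun i B _ _ => ∃ (A : Type u) (_ : AddCommGroup A) (_ : Module S A) (C : Type u)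
    (_ : AddCommGroup C) (_ : Module S C) (a : A →ₗ[S] B) (b : B →ₗ[S] C),
    Injective a ∧ Exact a b ∧ Surjective b ∧ P i A ∧ Q i C,
    ⟨A, _, _, C, _, _, a, b, ha, hab, hb, hP0, hQ0⟩, ?_⟩
  rintro i B _ _ ⟨A, _, _, C, _, _, a, b, ha, hab, hb, hA, hC⟩
  obtain ⟨KA, _, _, gA, fA, hgA, heA, hfA, hKA⟩ := hP i A hA
  obtain ⟨KC, _, _, gC, fC, hgC, heC, hfC, hKC⟩ := hQ i C hC
  obtain ⟨f, a', b', hf, ha', hab', hb'⟩ := horseshoe ha hab hb hgA heA hfA hgC heC hfC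
  let e : (Fin (r i + s i) → S) ≃ₗ[S] (Fin (r i) → S) × (Fin (s i) → S) :=
    LinearEquiv.funCongrLeft S S finSumFinEquiv ≪≫ₗ LinearEquiv.sumArrowLequivProdArrow _ _ S S
  refine ⟨LinearMap.ker f, _, _, e.symm.toLinearMap ∘ₗ (LinearMap.ker f).subtype,
    f ∘ₗ e.toLinearMap, e.symm.injective.comp Subtype.val_injective, fun v => ⟨fun h => ?_, ?_⟩,
    hf.comp e.surjective, KA, _, _, KC, _, _, a', b', ha', hab', hb', hKA, hKC⟩
  · exact ⟨⟨e v, h⟩, by simp⟩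
  · rintro ⟨k, rfl⟩
    simp

/-- Resolutions of the first two terms of a short exact sequence give one of the third term. -/
theorem cone {r s : ℕ → ℕ} {A B C : Type u} [AddCommGroup A] [AddCommGroup B] [AddCommGroup C]
    [Module S A] [Module S B] [Module S C] {a : A →ₗ[S] B} {b : B →ₗ[S] C} (ha : Injective a)
    (hab : Exact a b) (hb : Surjective b) (hA : HasRes S r A) (hB : HasRes S s B) :
    HasRes S (fun i => Nat.casesOn i (s 0) fun i => s (i + 1) + r i) C := by
  obtain ⟨L, _, _, g, f, hg, hgf, hf, hL⟩ := hB.exists_step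
  have hba (y : A) : b (a y) = 0 := hab.apply_apply_eq_zero y
  have hk (v : LinearMap.ker (b ∘ₗ f)) : ∃ y, a y = f v.1 := (hab _).1 v.2
  let a' : L →ₗ[S] LinearMap.ker (b ∘ₗ f) := g.codRestrict _ fun k => by
    simp [hgf.apply_apply_eq_zero k]
  have ha' (k : L) : (a' k : Fin (s 0) → S) = g k := rfl
  let b' : LinearMap.ker (b ∘ₗ f) →ₗ[S] A := LinearMap.codRestrictOfInjective
    (f ∘ₗ (LinearMap.ker (b ∘ₗ f)).subtype) a ha hk
  have hb' (v : LinearMap.ker (b ∘ₗ f)) : a (b' v) = f v.1 :=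
    LinearMap.codRestrictOfInjective_comp_apply _ _ ha hk v
  refine cons (LinearMap.ker (b ∘ₗ f)).subtype (b ∘ₗ f) Subtype.val_injective
    (LinearMap.exact_subtype_ker_map _) (hb.comp hf) (extension (a := a') (b := b') ?_ ?_ ?_ hL hA)
  · exact fun k k' h => hg (by simpa [ha'] using congrArg Subtype.val h)
  · refine fun v => ⟨fun h => ?_, ?_⟩
    · obtain ⟨k, hk⟩ := (hgf v.1).1 (by rw [← hb', h, map_zero])
      exact ⟨k, Subtype.ext hk⟩
    · rintro ⟨k, rfl⟩
      exact ha (by rw [hb', ha', hgf.apply_apply_eq_zero, map_zero])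
  · intro y
    obtain ⟨v, hv⟩ := hf (a y)
    exact ⟨⟨v, by simp [hv, hba]⟩, ha (by rw [hb', hv])⟩

end Basic

open TensorProduct in
/-- Resolutions are preserved by flat base change. -/
theorem baseChange {S : Type u} [CommRing S] (T : Type u) [CommRing T] [Algebra S T]
    [Module.Flat S T] {r : ℕ → ℕ} {M : Type u} [AddCommGroup M] [Module S M] (h : HasRes S r M) :
    HasRes T r (T ⊗[S] M) := by
  obtain ⟨P, hP0, hP⟩ := h
  refine ⟨fun i L _ _ => ∃ (K : Type u) (_ : AddCommGroup K) (_ : Module S K)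
    (_ : L ≃ₗ[T] T ⊗[S] K), P i K, ⟨M, _, _, .refl _ _, hP0⟩, ?_⟩
  rintro i L _ _ ⟨K, _, _, e, hK⟩
  obtain ⟨K', _, _, g, f, hg, hgf, hf, hK'⟩ := hP i K hK
  let p := TensorProduct.piScalarRight S T T (Fin (r i))
  refine ⟨T ⊗[S] K', _, _, p.toLinearMap ∘ₗ g.baseChange T,
    e.symm.toLinearMap ∘ₗ f.baseChange T ∘ₗ p.symm.toLinearMap,
    p.injective.comp (Module.Flat.lTensor_preserves_injective_linearMap g hg), fun v => ?_,
    e.symm.surjective.comp ((LinearMap.lTensor_surjective T hf).comp p.symm.surjective),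
    K', _, _, .refl _ _, hK'⟩
  have := Module.Flat.lTensor_exact T hgf (p.symm v)
  refine Iff.trans ?_ (this.trans ?_)
  · exact e.symm.map_eq_zero_iff
  · refine exists_congr fun k => ?_
    exact (LinearEquiv.eq_symm_apply p)

end HasRes

/-- Over a principal ideal ring, a submodule of `R ^ m` is generated by `m` elements. -/
theorem exists_range_eq_of_isPrincipalIdealRing {R : Type u} [CommRing R] [IsPrincipalIdealRing R] :
    ∀ (m : ℕ) (K : Submodule R (Fin m → R)), ∃ f : (Fin m → R) →ₗ[R] (Fin m → R),
      LinearMap.range f = K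
  | 0, K => ⟨0, Subsingleton.elim _ _⟩
  | m + 1, K => by
    let c : (Fin m → R) →ₗ[R] (Fin (m + 1) → R) :=
      { toFun := fun v => Fin.cons 0 v
        map_add' := fun v w => by ext i; cases i using Fin.cases <;> simp
        map_smul' := fun s v => by ext i; cases i using Fin.cases <;> simp }
    obtain ⟨g, hg⟩ := exists_range_eq_of_isPrincipalIdealRing m (K.comap c)
    have hgK (v) : c (g v) ∈ K := by
      have : g v ∈ K.comap c := hg ▸ LinearMap.mem_range_self g v
      exact this
    let I : Ideal R := K.map (LinearMap.proj 0)
    obtain ⟨a, ha⟩ := (IsPrincipalIdealRing.principal I).principal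
    obtain ⟨k, hk, hka⟩ : a ∈ I := ha ▸ Submodule.mem_span_singleton_self a
    replace hka : k 0 = a := hka
    refine ⟨(LinearMap.toSpanSingleton R _ k) ∘ₗ LinearMap.proj 0 +
      c ∘ₗ g ∘ₗ LinearMap.funLeft R R Fin.succ, le_antisymm ?_ fun v hv => ?_⟩
    · rintro _ ⟨v, rfl⟩
      exact K.add_mem (K.smul_mem _ hk) (hgK _)
    · have : v 0 ∈ I := ⟨v, hv, rfl⟩
      rw [ha, Submodule.mem_span_singleton] at this
      obtain ⟨t, ht⟩ := this
      have hcv : c (fun i => (v - t • k) i.succ) = v - t • k := by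
        ext i
        cases i using Fin.cases
        · simp [c, hka, ← ht]
        · simp [c]
      have : (fun i => (v - t • k) i.succ) ∈ LinearMap.range g := by
        rw [hg, Submodule.mem_comap, hcv]
        exact K.sub_mem hv (K.smul_mem _ hk)
      obtain ⟨w, hw⟩ := this
      refine ⟨Fin.cons t w, ?_⟩
      have hw' : LinearMap.funLeft R R Fin.succ (Fin.cons t w : Fin (m + 1) → R) = w := rfl
      simp only [LinearMap.add_apply, LinearMap.comp_apply, hw', hw, hcv]
      simp

open Function in
/-- Over a principal ideal ring, a module with `m` generators has a resolution by modules of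
rank `m`. -/
theorem HasRes.of_isPrincipalIdealRing {R : Type u} [CommRing R] [IsPrincipalIdealRing R]
    (M : Type u) [AddCommGroup M] [Module R M] [Module.Finite R M] :
    ∃ m, HasRes R (fun _ => m) M := by
  obtain ⟨m, f, hf⟩ := Module.Finite.exists_fin' R M
  refine ⟨m, fun _ K _ _ => ∃ f : (Fin m → R) →ₗ[R] K, Surjective f, ⟨f, hf⟩, ?_⟩
  rintro - K _ _ ⟨f, hf⟩
  obtain ⟨g, hg⟩ := exists_range_eq_of_isPrincipalIdealRing m (LinearMap.ker f)
  exact ⟨LinearMap.ker f, _, _, (LinearMap.ker f).subtype, f, Subtype.val_injective,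
    LinearMap.exact_subtype_ker_map _, hf, g.codRestrict _ fun v => hg ▸ LinearMap.mem_range_self g v,
    fun k => by
      obtain ⟨v, hv⟩ : (k : Fin m → R) ∈ LinearMap.range g := by rw [hg]; exact k.2
      exact ⟨v, Subtype.ext hv⟩⟩

namespace HasRes

open Function

/-- The data underlying a member of a class of modules. -/
structure ModuleIn (S : Type u) [CommRing S]
    (P : ∀ (K : Type u) [AddCommGroup K] [Module S K], Prop) where
  /-- the module -/
  carrier : Type u
  [addCommGroup : AddCommGroup carrier]
  [module : Module S carrier]
  mem : P carrier

attribute [instance] ModuleIn.addCommGroup ModuleIn.module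

/-- A resolution in the coinductive sense yields a free resolution of finite rank. -/
theorem exists_freeResolution {S : Type u} [CommRing S] {r : ℕ → ℕ} {M : Type u} [AddCommGroup M]
    [Module S M] (h : HasRes S r M) {M' : Type v} [AddCommGroup M'] [Module S M']
    (e : M ≃ₗ[S] M') :
    ∃ P : FreeResolution S M', P.FiniteRank ∧ ∀ p, (∀ i, p ≤ i → r i = r p) → P.RepeatsFrom p := by
  obtain ⟨P, h0, hP⟩ := h
  have step (i : ℕ) (X : ModuleIn S (P i)) : ∃ (Y : ModuleIn S (P (i + 1)))
      (g : Y.carrier →ₗ[S] (Fin (r i) → S)) (f : (Fin (r i) → S) →ₗ[S] X.carrier),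
      Exact g f ∧ Surjective f ∧ Injective g := by
    obtain ⟨L, _, _, g, f, hg, hgf, hf, hL⟩ := hP i X.carrier X.mem
    exact ⟨⟨L, hL⟩, g, f, hgf, hf, hg⟩
  choose next g f hgf hf hg using step
  let X (i : ℕ) : ModuleIn S (P i) := Nat.rec (motive := fun i => ModuleIn S (P i)) ⟨M, h0⟩ next i
  have hd (i : ℕ) : Exact (g i (X i) ∘ₗ f (i + 1) (X (i + 1))) (f i (X i)) := fun v => by
    rw [hgf i (X i) v]
    exact ⟨fun ⟨y, hy⟩ => (hf (i + 1) (X (i + 1)) y).imp fun w hw => by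
      rw [← hy, ← hw]; rfl, fun ⟨w, hw⟩ => ⟨f (i + 1) (X (i + 1)) w, hw⟩⟩
  refine ⟨{
    F := fun i => Fin (r i) → S
    d := fun i => g i (X i) ∘ₗ f (i + 1) (X (i + 1))
    aug := e.toLinearMap ∘ₗ f 0 (X 0)
    aug_surjective := e.surjective.comp (hf 0 (X 0))
    exact_zero := fun v => Iff.trans e.map_eq_zero_iff (hd 0 v)
    exact_succ := fun i v => Iff.trans
      ((g i (X i)).map_eq_zero_iff (hg i (X i))) (hd (i + 1) v) }, fun i => ?_, fun p hp i hi => ?_⟩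
  · exact inferInstanceAs (Module.Finite S (Fin (r i) → S))
  · exact ⟨LinearEquiv.funCongrLeft S S (finCongr (hp i hi).symm)⟩

end HasRes

section Polynomial

open TensorProduct Function

variable {S T M : Type u} [CommRing S] [CommRing T] [Algebra S T] [AddCommGroup M] [Module S M]
  [Module T M] [IsScalarTower S T M]

/-- For `S`-submodules `N' ≤ N` of a `T`-module with `x • N' ≤ N`, the map
`T ⊗ N' → T ⊗ N` given by `t ⊗ a ↦ x * t ⊗ a - t ⊗ x • a`. -/
def shiftMap (x : T) {N' N : Submodule S M} (h : N' ≤ N)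
    (hx : ∀ a ∈ N', x • a ∈ N) :
    T ⊗[S] N' →ₗ[T] T ⊗[S] N :=
  x • (Submodule.inclusion h).baseChange T -
    (((LinearMap.lsmul T M x).restrictScalars S).restrict hx).baseChange T

theorem shiftMap_one_tmul (x : T) {N' N : Submodule S M} (h : N' ≤ N)
    (hx : ∀ a ∈ N', x • a ∈ N) (a : N') :
    shiftMap x h hx (1 ⊗ₜ a) =
      x • ((1 : T) ⊗ₜ[S] (⟨a, h a.2⟩ : N)) - 1 ⊗ₜ (⟨x • (a : M), hx a a.2⟩ : N) := by
  rfl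

theorem Module.Basis.repr_mul_succ (b : Module.Basis ℕ S T) {x : T} (hb : ∀ i, b i = x ^ i) (t : T)
    (i : ℕ) : b.repr (x * t) (i + 1) = b.repr t i := by
  have : b.coord (i + 1) ∘ₗ LinearMap.mulLeft S x = b.coord i := b.ext fun j => by
    rw [LinearMap.comp_apply, LinearMap.mulLeft_apply, hb j, ← pow_succ', ← hb (j + 1), ← hb j]
    simp [Finsupp.single_apply]
  exact LinearMap.congr_fun this t

theorem shiftMap_injective (b : Module.Basis ℕ S T) {x : T} (hb : ∀ i, b i = x ^ i)
    {N' N : Submodule S M} (h : N' ≤ N) (hx : ∀ a ∈ N', x • a ∈ N) :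
    Injective (shiftMap x h hx) := by
  rw [injective_iff_map_eq_zero]
  intro z hz
  let c := equivFinsuppOfBasisLeft (N := N') b z
  have key (w : T ⊗[S] N') (i : ℕ) :
      (equivFinsuppOfBasisLeft (N := N) b (shiftMap x h hx w) (i + 1) : M) =
        equivFinsuppOfBasisLeft (N := N') b w i -
          x • (equivFinsuppOfBasisLeft (N := N') b w (i + 1) : M) := by
    induction w with
    | zero => simp
    | add w w' hw hw' =>
      simp only [map_add, Finsupp.add_apply, Submodule.coe_add, hw, hw', smul_add]
      abel
    | tmul t a =>
      have : shiftMap x h hx (t ⊗ₜ a) = (x * t) ⊗ₜ[S] (⟨a, h a.2⟩ : N) -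
          t ⊗ₜ (⟨x • (a : M), hx a a.2⟩ : N) := rfl
      simp [this, b.repr_mul_succ hb, smul_comm x]
  have hc (i : ℕ) : (c i : M) = x • (c (i + 1) : M) := by
    have := key z i
    rw [hz] at this
    simpa using (sub_eq_zero.1 this.symm)
  obtain ⟨B, hB⟩ : ∃ B, ∀ i, B ≤ i → c i = 0 := by
    obtain ⟨B, hB⟩ := c.support.bddAbove
    refine ⟨B + 1, fun i hi => ?_⟩
    by_contra hne
    have := hB (Finset.mem_coe.2 (Finsupp.mem_support_iff.2 hne))
    omega
  have hc0 (k : ℕ) : ∀ i, B ≤ i + k → c i = 0 := by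
    induction k with
    | zero => exact hB
    | succ k ih => exact fun i hi => Subtype.ext (by rw [hc, ih (i + 1) (by omega)]; simp)
  have : c = 0 := Finsupp.ext fun i => hc0 B i (by omega)
  exact (equivFinsuppOfBasisLeft (N := N') b).map_eq_zero_iff.1 this

/-- A finitely generated module over a Noetherian ring `T` with basis `1, x, x ^ 2, …` over `S` has
a two-term resolution by modules extended from finitely generated `S`-modules. -/
theorem exists_shiftMap_exact [IsNoetherianRing T] [Module.Finite T M] (b : Module.Basis ℕ S T)
    {x : T} (hb : ∀ i, b i = x ^ i) :
    ∃ (N' N : Submodule S M) (h : N' ≤ N) (hx : ∀ a ∈ N', x • a ∈ N), N'.FG ∧ N.FG ∧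
      Exact (shiftMap x h hx) (N.subtype.liftBaseChange T) ∧
      Surjective (N.subtype.liftBaseChange T) := by
  classical
  obtain ⟨m, π, hπ⟩ := Module.Finite.exists_fin' T M
  let D (d : ℕ) : Submodule S (Fin m → T) :=
    Submodule.span S ((fun p : Fin m × ℕ => Pi.single p.1 (x ^ p.2)) '' {p | p.2 < d})
  have hDmono : Monotone D := fun d d' h =>
    Submodule.span_mono (Set.image_mono fun p hp => lt_of_lt_of_le hp h)
  have hDfg (d : ℕ) : (D d).FG := Submodule.fg_span <| Set.Finite.image _ <|
    (Set.finite_univ.prod (Set.finite_lt_nat d)).subset fun p hp => ⟨trivial, hp⟩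
  have hD (q : Fin m → T) : ∃ d, q ∈ D d := by
    induction (Pi.basis fun _ : Fin m => b).mem_span q using Submodule.span_induction with
    | mem q hq =>
      obtain ⟨⟨j, i⟩, rfl⟩ := hq
      exact ⟨i + 1, Submodule.subset_span ⟨(j, i), Nat.lt_succ_self i, by simp [hb]⟩⟩
    | zero => exact ⟨0, Submodule.zero_mem _⟩
    | add q q' _ _ hq hq' =>
      obtain ⟨d, hd⟩ := hq
      obtain ⟨d', hd'⟩ := hq'
      exact ⟨max d d', Submodule.add_mem _ (hDmono (le_max_left _ _) hd)
        (hDmono (le_max_right _ _) hd')⟩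
    | smul s q _ hq => exact hq.imp fun d hd => Submodule.smul_mem _ s hd
  obtain ⟨s, hs⟩ : (LinearMap.ker π).FG := IsNoetherian.noetherian _
  choose deg hdeg using hD
  let d := s.sup deg
  have hsd (k) (hk : k ∈ s) : k ∈ D (d + 1) :=
    hDmono ((Finset.le_sup hk).trans (Nat.le_succ d)) (hdeg k)
  let πS : (Fin m → T) →ₗ[S] M := π.restrictScalars S
  let e (j : Fin m) : M := π (Pi.single j 1)
  have he (j : Fin m) (t : T) : π (Pi.single j t) = t • e j := by
    rw [← map_smul, ← Pi.single_smul, smul_eq_mul, mul_one]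
  have hmem (d' i : ℕ) (j : Fin m) (hi : i < d') : x ^ i • e j ∈ (D d').map πS :=
    ⟨_, Submodule.subset_span ⟨(j, i), hi, rfl⟩, he j _⟩
  have h : (D d).map πS ≤ (D (d + 1)).map πS := Submodule.map_mono (hDmono (Nat.le_succ d))
  have hx : ∀ a ∈ (D d).map πS, x • a ∈ (D (d + 1)).map πS := by
    rintro _ ⟨q, hq, rfl⟩
    induction hq using Submodule.span_induction with
    | mem q hq =>
      obtain ⟨⟨j, i⟩, hi, rfl⟩ := hq
      have := hmem (d + 1) (i + 1) j (Nat.succ_lt_succ hi)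
      rwa [pow_succ', mul_smul, ← he] at this
    | zero => simp
    | add q q' _ _ hq hq' => rw [map_add, smul_add]; exact Submodule.add_mem _ hq hq'
    | smul c q _ hq => rw [map_smul, smul_comm]; exact Submodule.smul_mem _ c hq
  refine ⟨(D d).map πS, (D (d + 1)).map πS, h, hx, (hDfg d).map _, (hDfg (d + 1)).map _, ?_⟩
  set N' := (D d).map πS
  set N := (D (d + 1)).map πS
  let μ := N.subtype.liftBaseChange T
  let I := LinearMap.range (shiftMap x h hx)
  let ε (j : Fin m) : N := ⟨e j, by
    have := hmem (d + 1) 0 j (Nat.succ_pos d)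
    rwa [pow_zero, one_smul] at this⟩
  let σ : (Fin m → T) →ₗ[T] T ⊗[S] N := Fintype.linearCombination T fun j => (1 : T) ⊗ₜ ε j
  have hσ (j : Fin m) (t : T) : σ (Pi.single j t) = t • (1 : T) ⊗ₜ[S] ε j :=
    Fintype.linearCombination_apply_single T _ j t
  have hμσ (q : Fin m → T) : μ (σ q) = π q := by
    have : μ ∘ₗ σ = π := LinearMap.pi_ext fun j t => by
      rw [LinearMap.comp_apply, hσ, he]; simp [μ, ε]
    exact LinearMap.congr_fun this q
  have hI : I ≤ LinearMap.ker μ := by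
    rintro _ ⟨z, rfl⟩
    have : μ ∘ₗ shiftMap x h hx = 0 := by
      ext a
      simp [shiftMap_one_tmul, μ]
    exact LinearMap.congr_fun this z
  have hpow (j : Fin m) (i : ℕ) (hi : i ≤ d) (n : N) (hn : (n : M) = x ^ i • e j) :
      x ^ i • ((1 : T) ⊗ₜ[S] ε j) - 1 ⊗ₜ n ∈ I := by
    induction i generalizing n with
    | zero =>
      have : n = ε j := Subtype.ext (by rw [hn, pow_zero, one_smul])
      simp [this]
    | succ i ih =>
      let a : N' := ⟨x ^ i • e j, hmem d i j hi⟩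
      have h1 := I.smul_mem x (ih (Nat.le_of_succ_le hi) ⟨a, h a.2⟩ rfl)
      have h2 : shiftMap x h hx (1 ⊗ₜ a) ∈ I := LinearMap.mem_range_self _ _
      have : n = ⟨x • (a : M), hx a a.2⟩ := Subtype.ext (by rw [hn, pow_succ', mul_smul])
      rw [shiftMap_one_tmul, ← this] at h2
      convert I.add_mem h1 h2 using 1
      rw [smul_sub, smul_smul, ← pow_succ']
      abel
  have hlow (q : Fin m → T) (hq : q ∈ D (d + 1)) (n : N) (hn : (n : M) = π q) :
      σ q - 1 ⊗ₜ n ∈ I := by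
    induction hq using Submodule.span_induction generalizing n with
    | mem q hq =>
      obtain ⟨⟨j, i⟩, hi, rfl⟩ := hq
      rw [hσ]
      exact hpow j i (Nat.lt_succ_iff.1 hi) n (by rw [hn, he])
    | zero =>
      have : n = 0 := Subtype.ext (by simpa using hn)
      simp [this]
    | add q q' hq hq' ih ih' =>
      let n₁ : N := ⟨π q, q, hq, rfl⟩
      let n₂ : N := ⟨π q', q', hq', rfl⟩
      have : n = n₁ + n₂ := Subtype.ext (by rw [hn, map_add]; rfl)
      convert I.add_mem (ih n₁ rfl) (ih' n₂ rfl) using 1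
      rw [this, map_add, tmul_add]
      abel
    | smul c q hq ih =>
      let n₁ : N := ⟨π q, q, hq, rfl⟩
      have : n = c • n₁ := Subtype.ext (by rw [hn, LinearMap.map_smul_of_tower]; rfl)
      rw [this, LinearMap.map_smul_of_tower, tmul_smul]
      have := I.smul_of_tower_mem c (ih n₁ rfl)
      rwa [smul_sub] at this
  have hall (z : T ⊗[S] N) : ∃ q, z - σ q ∈ I := by
    induction z with
    | zero => exact ⟨0, by simp⟩
    | add z z' hz hz' =>
      obtain ⟨q, hq⟩ := hz
      obtain ⟨q', hq'⟩ := hz'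
      refine ⟨q + q', ?_⟩
      convert I.add_mem hq hq' using 1
      rw [map_add]
      abel
    | tmul t n =>
      obtain ⟨q, hq, hn⟩ := n.2
      refine ⟨t • q, ?_⟩
      convert I.smul_mem (-t) (hlow q hq n hn.symm) using 1
      rw [map_smul, neg_smul, smul_sub, smul_tmul', smul_eq_mul, mul_one]
      abel
  refine ⟨fun z => ⟨fun hz => ?_, fun hz => hI hz⟩, fun y => ?_⟩
  · obtain ⟨q, hq⟩ := hall z
    have hq0 : q ∈ LinearMap.ker π := by
      have := hI hq
      rw [LinearMap.mem_ker, map_sub, hμσ] at this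
      rw [LinearMap.mem_ker, ← sub_eq_zero.1 this]
      exact hz
    have hσI : LinearMap.ker π ≤ I.comap σ := by
      rw [← hs, Submodule.span_le]
      intro k hk
      have hk0 : π k = 0 := (hs ▸ Submodule.subset_span hk : k ∈ LinearMap.ker π)
      simpa using hlow k (hsd k hk) 0 (by simp [hk0])
    have := I.add_mem hq (hσI hq0)
    rwa [sub_add_cancel] at this
  · obtain ⟨q, rfl⟩ := hπ y
    exact ⟨σ q, hμσ q⟩

/-- Passing from `S` to a polynomial ring in one variable over `S` raises by one the degree from
which ranks of resolutions can be chosen constant. -/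
theorem exists_hasRes_of_basis_pow [IsNoetherianRing T] [Module.Finite T M]
    (b : Module.Basis ℕ S T) {x : T} (hb : ∀ i, b i = x ^ i) {n : ℕ}
    (H : ∀ (N : Type u) [AddCommGroup N] [Module S N] [Module.Finite S N],
      ∃ r, HasRes S r N ∧ ∀ i, n ≤ i → r i = r n) :
    ∃ r, HasRes T r M ∧ ∀ i, n + 1 ≤ i → r i = r (n + 1) := by
  obtain ⟨N', N, h, hx, hN', hN, hex, hsurj⟩ := exists_shiftMap_exact (M := M) b hb
  have := Module.Finite.iff_fg.2 hN'
  have := Module.Finite.iff_fg.2 hN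
  have := Module.Free.of_basis b
  obtain ⟨r, hr, hrn⟩ := H N'
  obtain ⟨s, hs, hsn⟩ := H N
  refine ⟨_, .cone (shiftMap_injective b hb h hx) hex hsurj (hr.baseChange T) (hs.baseChange T), ?_⟩
  rintro (_ | i) hi
  · omega
  · change s (i + 1) + r i = s (n + 1) + r n
    rw [hsn (i + 1) (by omega), hsn (n + 1) (by omega), hrn i (by omega)]

end Polynomial

/-- **Hilbert's syzygy theorem** over a principal ideal ring: a finitely generated module over the
polynomial ring in `n` variables has a resolution by free modules of finite rank, with constant
rank from degree `n` on. -/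
theorem exists_hasRes_mvPolynomial {R : Type u} [CommRing R] [IsPrincipalIdealRing R] (n : ℕ) :
    ∀ (M : Type u) [AddCommGroup M] [Module (MvPolynomial (Fin n) R) M]
      [Module.Finite (MvPolynomial (Fin n) R) M],
      ∃ r, HasRes (MvPolynomial (Fin n) R) r M ∧ ∀ i, n ≤ i → r i = r n := by
  induction n with
  | zero =>
    intro M _ _ _
    have : IsPrincipalIdealRing (MvPolynomial (Fin 0) R) :=
      .of_surjective (MvPolynomial.isEmptyAlgEquiv R (Fin 0)).symm
        (MvPolynomial.isEmptyAlgEquiv R (Fin 0)).symm.surjective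
    obtain ⟨m, hm⟩ := HasRes.of_isPrincipalIdealRing (R := MvPolynomial (Fin 0) R) M
    exact ⟨_, hm, fun _ _ => rfl⟩
  | succ n ih =>
    intro M _ _ _
    let e := MvPolynomial.finSuccEquiv R n
    let φ : MvPolynomial (Fin n) R →+* MvPolynomial (Fin (n + 1)) R :=
      e.symm.toRingHom.comp Polynomial.C
    let := φ.toAlgebra
    let := Module.compHom M φ
    have : IsScalarTower (MvPolynomial (Fin n) R) (MvPolynomial (Fin (n + 1)) R) M :=
      .of_algebraMap_smul fun _ _ => rfl
    let e' : Polynomial (MvPolynomial (Fin n) R) ≃ₐ[MvPolynomial (Fin n) R]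
        MvPolynomial (Fin (n + 1)) R := .ofRingEquiv (f := e.symm.toRingEquiv) fun _ => rfl
    refine exists_hasRes_of_basis_pow
      ((Polynomial.basisMonomials (MvPolynomial (Fin n) R)).map e'.toLinearEquiv)
      (x := e' Polynomial.X) (fun i => ?_) ih
    rw [← map_pow, ← Polynomial.monomial_one_right_eq_X_pow]
    simp

theorem mainTheorem2 (R : Type u) [CommRing R] (n : ℕ)
    (M : Type v) [AddCommGroup M] [Module (MvPolynomial (Fin n) R) M]
    [Module.Finite (MvPolynomial (Fin n) R) M] :
    (∀ (k : ℕ) (A : Fin k → Type w) [∀ i, CommRing (A i)] [∀ i, IsDomain (A i)]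
        [∀ i, IsPrincipalIdealRing (A i)] (N : ∀ i, A i),
        (R ≃+* (∀ i, A i ⧸ Ideal.span {N i})) →
        ∃ P : FreeResolution (MvPolynomial (Fin n) R) M,
          P.FiniteRank ∧ ∃ p, p ≤ n + 1 ∧ P.RepeatsFrom p) ∧
    (IsPrincipalIdealRing R →
        ∃ P : FreeResolution (MvPolynomial (Fin n) R) M,
          P.FiniteRank ∧ ∃ p, p ≤ n + 1 ∧ P.RepeatsFrom p) := by
  have main : IsPrincipalIdealRing R → ∃ P : FreeResolution (MvPolynomial (Fin n) R) M,
      P.FiniteRank ∧ ∃ p, p ≤ n + 1 ∧ P.RepeatsFrom p := by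
    intro _
    obtain ⟨m, f, hf⟩ := Module.Finite.exists_fin' (MvPolynomial (Fin n) R) M
    obtain ⟨r, hr, hrn⟩ := exists_hasRes_mvPolynomial (R := R) n
      ((Fin m → MvPolynomial (Fin n) R) ⧸ LinearMap.ker f)
    obtain ⟨P, hP, hPr⟩ := hr.exists_freeResolution (f.quotKerEquivOfSurjective hf)
    exact ⟨P, hP, n, n.le_succ, hPr n hrn⟩
  refine ⟨fun k A _ _ _ N e => main ?_, main⟩
  have (i : Fin k) : IsPrincipalIdealRing (A i ⧸ Ideal.span {N i}) :=
    .of_surjective (Ideal.Quotient.mk _) Ideal.Quotient.mk_surjective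
  exact .of_surjective e.symm e.symm.surjective
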